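/- Let $\mathcal X$ be a finite set. For a probability distribution $\mathcal D$ on $\mathcal X$, a family $\mathcal F$ of functions $\mathcal X\to[0,1]$, an error $e$, and functions $g,h:\mathcal X\to[0,1]$, say that $h$ is $(\mathcal F,e)$-regular (for $g$ under $\mathcal D$) if $\bigl|\mathbb E_{x\sim\mathcal D}[f(x)(g(x)-h(x))]\bigr|\le e$ for all $f\in\mathcal F$. For $s=(s_1,s_2)\in\mathbb N^2$ let $\mathcal F_s$ be the class of functions $h:\mathcal X\to[0,1]$ for which there are $k\le s_1$, functions $f_1,\dots,f_k\in\mathcal F$, and a Boolean circuit with at most $s_2$ gates (of fan-in two, constants being free) that computes $h(x)$ in binary, with finitely many digits, from the binary expansions of $f_1(x),\dots,f_k(x)$, for every $x\in\mathcal X$. Order $\mathbb N^2$ coordinatewise. Let $\mathcal D$, $\mathcal F$ and $g:\mathcal X\to[0,1]$ be given, let $\varepsilon:\mathbb N^2\to(0,1/2)$ be nonincreasing, $\alpha\in(0,1/2)$, and $G:\mathbb N^2\to\mathbb N^2$ nondecreasing. For constants $A,B>0$ and $c\in\mathbb N$, put $S_0=(1,1)$ and $$S_{i+1}=\Bigl\lceil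 \frac{B}{\varepsilon(S_i)^{2}}\Bigr\rceil G(S_i)+\Bigl(0,\Bigl\lceil \frac{B}{\varepsilon(S_i)^{3}}\Bigl(\log\frac1{\varepsilon(S_i)}\Bigr)^{c}\Bigr\rceil\Bigr),$$ and call $(s,s',h,h')$ with $s,s'\in\mathbb N^2$, $h\in\mathcal F_s$, $h'\in\mathcal F_{s'}$ a *supersimulator pair with constants $A,B,c$* if * (similarity) $\mathbb E_{x\sim\mathcal D}(h(x)-h'(x))^2\le\alpha+A\,\varepsilon(s)$, * (regularity) $h'$ is $(\mathcal F_{G(s)},\varepsilon(s))$-regular, * (complexity) $s,s'\le S_{\lfloor1/\alpha\rfloor}$. Then: 1. There are absolute constants $A,B>0$ and $c\in\mathbb N$ such that, for all $\mathcal X,\mathcal D,\mathcal F,g,\varepsilon,\alpha,G$ as above, a supersimulator pair with constants $A,B,c$ exists. 2. For every $A>0$ there is a constant $K>0$, depending only on $A$, such that for all $B>0$, $c\in\mathbb N$, all $\mathcal X,\mathcal D,\mathcal F,g,\varepsilon,\alpha,G$ as above and every supersimulator pair $(s,s',h,h')$ with constants $A,B,c$, the function $h$ itself is $\bigl(\mathcal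 F_{G(s)},(K(\alpha+\varepsilon(s)))^{1/3}\bigr)$-regular. -/

import Mathlib

namespace Supersimulator

/-- A place from which a circuit reads a bit: a constant, the binary digit of weight `2 ^ (-j)` of
the `i`-th real input, or the output of the `t`-th gate. -/
inductive Wire (k : ℕ) : Type
  | const (b : Bool) : Wire k
  | input (i : Fin k) (j : ℕ) : Wire k
  | gate (t : ℕ) : Wire k

/-- The bit carried by a wire, where `vals` lists the outputs of the gates evaluated so far. A gate
that has not been evaluated yet reads as the constant `false`, so there are no cycles. -/
def Wire.value {k : ℕ} (inp : Fin k → ℕ → Bool) (vals : List Bool) : Wire k → Bool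
  | .const b => b
  | .input i j => inp i j
  | .gate t => vals.getD t false

/-- A gate: any Boolean operation of fan-in two. -/
structure Gate (k : ℕ) : Type where
  op : Bool → Bool → Bool
  left : Wire k
  right : Wire k

/-- A Boolean circuit that reads (finitely many) binary digits of `k` inputs and has `m` output
bits; its gates are listed in the order of evaluation. -/
structure Circuit (k m : ℕ) : Type where
  gates : List (Gate k)
  out : Fin m → Wire k

/-- The size of a circuit is its number of gates. -/
def Circuit.size {k m : ℕ} (C : Circuit k m) : ℕ := C.gates.length

/-- The outputs of a list of gates, evaluated from left to right. -/
def runGates {k : ℕ} (inp : Fin k → ℕ → Bool) (gates : List (Gate k)) : List Bool :=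
  gates.foldl
    (fun vals γ => vals ++ [γ.op (γ.left.value inp vals) (γ.right.value inp vals)]) []

/-- The `m` output bits of a circuit. -/
def Circuit.eval {k m : ℕ} (C : Circuit k m) (inp : Fin k → ℕ → Bool) (j : Fin m) : Bool :=
  (C.out j).value inp (runGates inp C.gates)

/-- The digit of weight `2 ^ (-j)` in the binary expansion of `r ∈ [0, 1]`; the digit `j = 0` is
the integer part. -/
noncomputable def binaryDigit (r : ℝ) (j : ℕ) : Bool :=
  decide (⌊(2 : ℝ) ^ j * r⌋₊ % 2 = 1)

/-- The number whose binary digits of weights `1, 1/2, 1/4, …` are given. -/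
noncomputable def ofBits {m : ℕ} (c : Fin m → Bool) : ℝ :=
  ∑ j : Fin m, if c j then ((1 : ℝ) / 2) ^ (j : ℕ) else 0

/-- The class `F_{(s₁, s₂)}`: all `h` for which there are `f₁, …, f_k ∈ F` with `k ≤ s₁` and a
Boolean circuit of size at most `s₂` that computes `h x` in binary, given only
`f₁ x, …, f_k x` (in binary). -/
def simClass {X : Type*} (F : Set (X → unitInterval)) (s : ℕ × ℕ) : Set (X → unitInterval) :=
  {h | ∃ k : ℕ, k ≤ s.1 ∧ ∃ f : Fin k → X → unitInterval, (∀ i, f i ∈ F) ∧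
    ∃ (m : ℕ) (C : Circuit k m), C.size ≤ s.2 ∧
      ∀ x, (h x : ℝ) = ofBits (C.eval fun i j => binaryDigit (f i x : ℝ) j)}

/-- The expectation of `φ x` for `x` drawn from the distribution `D` on a finite set. -/
def expect {X : Type*} [Fintype X] (D : X → ℝ) (φ : X → ℝ) : ℝ := ∑ x, D x * φ x

/-- `h` is an `(F, e)`-regular simulator for `g` under `D`. -/
def IsRegular {X : Type*} [Fintype X] (D : X → ℝ) (F : Set (X → unitInterval)) (e : ℝ)
    (g h : X → unitInterval) : Prop :=
  ∀ f ∈ F, |expect D fun x => (f x : ℝ) * ((g x : ℝ) - (h x : ℝ))| ≤ e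

/-- The size bounds `S₀ = (1, 1)` and
`S_{i+1} = O(1 / ε(S_i)²) G(S_i) + (0, Õ(1 / ε(S_i)³))`, with explicit constant `B` in both terms
and explicit exponent `c` of the logarithm. -/
noncomputable def sizeBound (ε : ℕ × ℕ → ℝ) (G : ℕ × ℕ → ℕ × ℕ) (B : ℝ) (c : ℕ) : ℕ → ℕ × ℕ
  | 0 => (1, 1)
  | i + 1 =>
    let S := sizeBound ε G B c i
    ⌈B / ε S ^ 2⌉₊ • G S + (0, ⌈B / ε S ^ 3 * Real.log (1 / ε S) ^ c⌉₊)

/-- The pairs `h ∈ F_s`, `h' ∈ F_{s'}` of the expanding and shrinking supersimulator theorem: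
`h'` is regular with error `ε(s)` against `F_{G(s)}`, `h` is `L²`-close to `h'`, and the sizes are
bounded. The constants hidden by the `O`-notation are `A` (similarity) and `B`, `c` (sizes). -/
structure IsSupersimulatorPair {X : Type*} [Fintype X] (A B : ℝ) (c : ℕ)
    (D : X → ℝ) (F : Set (X → unitInterval)) (g : X → unitInterval) (ε : ℕ × ℕ → ℝ) (α : ℝ)
    (G : ℕ × ℕ → ℕ × ℕ) (s s' : ℕ × ℕ) (h h' : X → unitInterval) : Prop where
  mem_left : h ∈ simClass F s
  mem_right : h' ∈ simClass F s'
  similarity : (expect D fun x => ((h x : ℝ) - (h' x : ℝ)) ^ 2) ≤ α + A * ε s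
  regularity : IsRegular D (simClass F (G s)) (ε s) g h'
  size_left : s ≤ sizeBound ε G B c ⌊1 / α⌋₊
  size_right : s' ≤ sizeBound ε G B c ⌊1 / α⌋₊

end Supersimulator

/-! Boosting keeps an unclipped sum H of steps ± 2^(-b) u and predicts `clip (H x)`. Progress is
measured by the energy 2 E[Φ(H) - gH + g²/2], where Φ is convex with Φ' = `clip`. As `clip` is
1-Lipschitz, Φ is smooth, so a test violating regularity with error e yields a step of size δ ≈ e
that lowers the energy by order δe (`exists_boost_step`). Conversely, cocoercivity of `clip` bounds
E(clip H - clip H')² by the energy drop plus a cross term -2 E[(g - clip H')(H' - H)]. If H' is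
regular, this term is small, because H' - H is a signed sum of scaled tests: n steps contribute
O(nδe), which the drop itself dominates (`exists_regular_boost`, `IsStage.exists_next`).

Each stage boosts against F_{G(S)} until the error is at most ε(S). The energy starts at most 1/4
and stays nonnegative, so one of the ⌊1/α⌋ stages drops by less than 13α/29; its two ends are h and
h'.

Since only the final sum is clipped, a prediction is computed afresh from all its steps. The energy
allows O(1/ε²) of them in total, which gives the term O(1/ε²) G(S). Tests truncated to O(log(1/ε))
digits make the additions exact in fixed point (`IsBoost.exists_bits`, `IsBoost.clip_mem`).

The regularity of h is the triangle inequality with Cauchy–Schwarz, which even gives an error O(√(α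
+ ε)). -/

namespace Supersimulator

/-! ### Composition of Boolean circuits; binary addition -/

section Circuits

variable {X : Type*} {k K : ℕ}

theorem Wire.value_gate (inp : Fin k → ℕ → Bool) (vals : List Bool) (t : ℕ) :
    (Wire.gate t).value inp vals = vals.getD t false := rfl

theorem runGates_append_singleton (inp : Fin k → ℕ → Bool) (gs : List (Gate k)) (γ : Gate k) :
    runGates inp (gs ++ [γ]) = runGates inp gs ++
      [γ.op (γ.left.value inp (runGates inp gs)) (γ.right.value inp (runGates inp gs))] := by
  simp [runGates]

theorem length_runGates (inp : Fin k → ℕ → Bool) (gs : List (Gate k)) :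
    (runGates inp gs).length = gs.length := by
  induction gs using List.reverseRecOn with
  | nil => rfl
  | append_singleton gs γ ih => simp [runGates_append_singleton, ih]

theorem exists_runGates_append (inp : Fin k → ℕ → Bool) (gs es : List (Gate k)) :
    ∃ r, runGates inp (gs ++ es) = runGates inp gs ++ r := by
  induction es using List.reverseRecOn with
  | nil => exact ⟨[], by simp⟩
  | append_singleton es γ ih =>
    obtain ⟨r, hr⟩ := ih
    rw [← List.append_assoc, runGates_append_singleton, hr, List.append_assoc]
    exact ⟨_, rfl⟩

/-- Some wire carries the bit `φ x` on the input `inp x`, also when further gates are appended. -/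
def Available (inp : X → Fin k → ℕ → Bool) (gates : List (Gate k)) (φ : X → Bool) : Prop :=
  ∃ w : Wire k, ∀ es x, w.value (inp x) (runGates (inp x) (gates ++ es)) = φ x

theorem Available.append {inp : X → Fin k → ℕ → Bool} {gates : List (Gate k)} {φ : X → Bool}
    (h : Available inp gates φ) (es : List (Gate k)) : Available inp (gates ++ es) φ := by
  obtain ⟨w, hw⟩ := h
  exact ⟨w, fun es' x => by rw [List.append_assoc, hw]⟩

theorem available_const (inp : X → Fin k → ℕ → Bool) (gates : List (Gate k)) (b : Bool) :
    Available inp gates fun _ => b :=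
  ⟨.const b, fun _ _ => rfl⟩

theorem available_input (inp : X → Fin k → ℕ → Bool) (gates : List (Gate k)) (i : Fin k) (j : ℕ) :
    Available inp gates fun x => inp x i j :=
  ⟨.input i j, fun _ _ => rfl⟩

theorem Available.gate {inp : X → Fin k → ℕ → Bool} {gates : List (Gate k)} {φ ψ : X → Bool}
    (hφ : Available inp gates φ) (hψ : Available inp gates ψ) (op : Bool → Bool → Bool) :
    ∃ γ, Available inp (gates ++ [γ]) fun x => op (φ x) (ψ x) := by
  obtain ⟨v, hv⟩ := hφ
  obtain ⟨w, hw⟩ := hψ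
  refine ⟨⟨op, v, w⟩, .gate gates.length, fun es x => ?_⟩
  obtain ⟨r, hr⟩ := exists_runGates_append (inp x) (gates ++ [⟨op, v, w⟩]) es
  have hv' := hv [] x
  have hw' := hw [] x
  rw [List.append_nil] at hv' hw'
  rw [hr, runGates_append_singleton, hv', hw']
  simp [Wire.value, List.getD, length_runGates]

/-- A circuit can be copied behind an existing list of gates. -/
theorem exists_available_copy (ι : Fin k → Fin K) (inp : X → Fin K → ℕ → Bool)
    (gates : List (Gate K)) (gs : List (Gate k)) :
    ∃ es : List (Gate K), es.length = gs.length ∧ ∀ w : Wire k,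
      Available inp (gates ++ es) fun x =>
        w.value (fun i => inp x (ι i)) (runGates (fun i => inp x (ι i)) gs) := by
  induction gs using List.reverseRecOn with
  | nil =>
    refine ⟨[], rfl, fun w => ?_⟩
    cases w with
    | const b => exact available_const _ _ b
    | input i j => exact available_input _ _ (ι i) j
    | gate t => exact available_const _ _ false
  | append_singleton gs γ ih =>
    obtain ⟨es, hes, h⟩ := ih
    obtain ⟨γ', hγ⟩ := (h γ.left).gate (h γ.right) γ.op
    refine ⟨es ++ [γ'], by simp [hes], fun w => ?_⟩
    rw [← List.append_assoc]
    cases w with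
    | const b => exact available_const _ _ b
    | input i j => exact available_input _ _ (ι i) j
    | gate t =>
      simp only [runGates_append_singleton, Wire.value_gate]
      -- A reference points to an old gate, to the new one, or past the end, where it reads `false`.
      rcases lt_trichotomy t gs.length with ht | rfl | ht
      · refine (congrArg _ (funext fun x => ?_)).mp ((h (.gate t)).append [γ'])
        rw [Wire.value_gate, List.getD_append _ _ _ _ (by rwa [length_runGates])]
      · refine (congrArg _ (funext fun x => ?_)).mp hγ
        rw [List.getD_append_right _ _ _ _ (by rw [length_runGates]), length_runGates, Nat.sub_self]
        rfl
      · refine (congrArg _ (funext fun x => ?_)).mp (available_const _ _ false)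
        rw [List.getD_eq_default]
        simpa [length_runGates] using ht

/-- All functions in `S` are computed by one circuit of complexity `s` from functions in `F`. -/
def BitsComputable (F : Set (X → unitInterval)) (s : ℕ × ℕ) (S : Set (X → Bool)) : Prop :=
  ∃ k : ℕ, k ≤ s.1 ∧ ∃ f : Fin k → X → unitInterval, (∀ i, f i ∈ F) ∧
    ∃ gates : List (Gate k), gates.length ≤ s.2 ∧
      ∀ φ ∈ S, Available (fun x i j => binaryDigit (f i x : ℝ) j) gates φ

variable {F : Set (X → unitInterval)} {s t : ℕ × ℕ} {S T : Set (X → Bool)}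

theorem BitsComputable.mono (h : BitsComputable F s S) (hst : s ≤ t) (hT : T ⊆ S) :
    BitsComputable F t T := by
  obtain ⟨k, hk, f, hf, gates, hg, hS⟩ := h
  exact ⟨k, hk.trans hst.1, f, hf, gates, hg.trans hst.2, fun φ hφ => hS φ (hT hφ)⟩

theorem bitsComputable_empty : BitsComputable F s ∅ :=
  ⟨0, Nat.zero_le _, Fin.elim0, fun i => i.elim0, [], Nat.zero_le _, by simp⟩

theorem BitsComputable.const (h : BitsComputable F s S) :
    BitsComputable F s (S ∪ Set.range fun b _ => b) := by
  obtain ⟨k, hk, f, hf, gates, hg, hS⟩ := h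
  refine ⟨k, hk, f, hf, gates, hg, ?_⟩
  rintro φ (hφ | ⟨b, rfl⟩)
  · exact hS φ hφ
  · exact available_const _ _ b

/-- Both gate lists run one after the other on the concatenated inputs. -/
theorem BitsComputable.union (hS : BitsComputable F s S) (hT : BitsComputable F t T) :
    BitsComputable F (s + t) (S ∪ T) := by
  obtain ⟨k₁, hk₁, f₁, hf₁, gs₁, hg₁, h₁⟩ := hS
  obtain ⟨k₂, hk₂, f₂, hf₂, gs₂, hg₂, h₂⟩ := hT
  obtain ⟨es₁, hes₁, hw₁⟩ := exists_available_copy (Fin.castAdd k₂)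
    (fun x i j => binaryDigit (Fin.append f₁ f₂ i x : ℝ) j) [] gs₁
  obtain ⟨es₂, hes₂, hw₂⟩ := exists_available_copy (Fin.natAdd k₁)
    (fun x i j => binaryDigit (Fin.append f₁ f₂ i x : ℝ) j) ([] ++ es₁) gs₂
  refine ⟨k₁ + k₂, Nat.add_le_add hk₁ hk₂, Fin.append f₁ f₂, fun i => ?_, [] ++ es₁ ++ es₂, ?_, ?_⟩
  · refine Fin.addCases (fun i => ?_) (fun i => ?_) i
    · simpa using hf₁ i
    · simpa using hf₂ i
  · simpa [hes₁, hes₂] using Nat.add_le_add hg₁ hg₂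
  · rintro φ (hφ | hφ)
    · obtain ⟨w, hw⟩ := h₁ φ hφ
      refine (congrArg _ (funext fun x => ?_)).mp ((hw₁ w).append es₂)
      simpa using hw [] x
    · obtain ⟨w, hw⟩ := h₂ φ hφ
      refine (congrArg _ (funext fun x => ?_)).mp (hw₂ w)
      simpa using hw [] x

theorem BitsComputable.gate (h : BitsComputable F s S) {φ ψ : X → Bool} (hφ : φ ∈ S) (hψ : ψ ∈ S)
    (op : Bool → Bool → Bool) :
    BitsComputable F (s + (0, 1)) (insert (fun x => op (φ x) (ψ x)) S) := by
  obtain ⟨k, hk, f, hf, gates, hg, hS⟩ := h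
  obtain ⟨γ, hγ⟩ := (hS φ hφ).gate (hS ψ hψ) op
  refine ⟨k, hk, f, hf, gates ++ [γ], by simpa using hg, ?_⟩
  rintro χ (rfl | hχ)
  · exact hγ
  · exact (hS χ hχ).append _

theorem BitsComputable.gates (h : BitsComputable F s S) {φ ψ : ℕ → X → Bool} (hφ : ∀ j, φ j ∈ S)
    (hψ : ∀ j, ψ j ∈ S) (op : Bool → Bool → Bool) (w : ℕ) :
    BitsComputable F (s + (0, w)) (S ∪ (fun j x => op (φ j x) (ψ j x)) '' Set.Iio w) := by
  induction w with
  | zero => exact h.mono le_rfl (by simp)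
  | succ w ih =>
    refine (ih.gate (Or.inl (hφ w)) (Or.inl (hψ w)) op).mono le_rfl ?_
    rintro χ (hχ | ⟨j, hj, rfl⟩)
    · exact Or.inr (Or.inl hχ)
    · rcases Nat.lt_succ_iff_lt_or_eq.mp hj with hj | rfl
      · exact Or.inr (Or.inr ⟨j, hj, rfl⟩)
      · exact Or.inl rfl

/-- The disjunction of the first `w` bits. -/
def anyBit (a : ℕ → Bool) : ℕ → Bool
  | 0 => false
  | w + 1 => anyBit a w || a w

theorem anyBit_eq_false {a : ℕ → Bool} {w : ℕ} : anyBit a w = false ↔ ∀ j < w, a j = false := by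
  induction w with
  | zero => simp [anyBit]
  | succ w ih => rw [anyBit, Bool.or_eq_false_iff, ih, Nat.forall_lt_succ_right]

theorem BitsComputable.anyBit (h : BitsComputable F s S) {a : ℕ → X → Bool} (ha : ∀ j, a j ∈ S)
    (w : ℕ) : BitsComputable F (s + (0, w))
      (insert (fun x => Supersimulator.anyBit (fun j => a j x) w) S) := by
  induction w with
  | zero =>
    refine h.const.mono le_rfl ?_
    rintro χ (rfl | hχ)
    · exact Or.inr ⟨false, rfl⟩
    · exact Or.inl hχ
  | succ w ih =>
    refine (ih.gate (Or.inl rfl) (Or.inr (ha w)) or).mono le_rfl ?_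
    rintro χ (rfl | hχ)
    · exact Or.inl rfl
    · exact Or.inr (Or.inr hχ)

/-- The carry into position `j` in the addition of `a` and `b` with initial carry `c`. -/
def carryBit (a b : ℕ → Bool) (c : Bool) : ℕ → Bool
  | 0 => c
  | j + 1 => (a j && b j) || ((a j ^^ b j) && carryBit a b c j)

/-- The digit at position `j` in the sum of `a` and `b` with initial carry `c`. -/
def sumBit (a b : ℕ → Bool) (c : Bool) (j : ℕ) : Bool := (a j ^^ b j) ^^ carryBit a b c j

theorem BitsComputable.adder (h : BitsComputable F s S) {a b : ℕ → X → Bool} (ha : ∀ j, a j ∈ S)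
    (hb : ∀ j, b j ∈ S) (c : Bool) (w : ℕ) :
    BitsComputable F (s + (0, 5 * w))
      (insert (fun x => carryBit (fun j => a j x) (fun j => b j x) c w)
        (S ∪ (fun i x => sumBit (fun j => a j x) (fun j => b j x) c i) '' Set.Iio w)) := by
  induction w with
  | zero =>
    refine h.const.mono le_rfl ?_
    rintro χ (rfl | hχ | hχ)
    · exact Or.inr ⟨c, rfl⟩
    · exact Or.inl hχ
    · simp at hχ
  | succ w ih =>
    -- Five gates per position: a xor b, the sum digit, the propagated carry, the generated carry,
    -- and the next carry.
    have h₁ := ih.gate (Or.inr (Or.inl (ha w))) (Or.inr (Or.inl (hb w))) xor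
    have h₂ := h₁.gate (Or.inl rfl) (Or.inr (Or.inl rfl)) xor
    have h₃ := h₂.gate (Or.inr (Or.inl rfl)) (Or.inr (Or.inr (Or.inl rfl))) and
    have h₄ := h₃.gate (Or.inr (Or.inr (Or.inr (Or.inr (Or.inl (ha w))))))
      (Or.inr (Or.inr (Or.inr (Or.inr (Or.inl (hb w)))))) and
    have h₅ := h₄.gate (Or.inl rfl) (Or.inr (Or.inl rfl)) or
    refine h₅.mono (le_of_eq (by ext <;> simp; ring)) ?_
    rintro χ (rfl | hχ | ⟨j, hj, rfl⟩)
    · exact Or.inl rfl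
    · exact Or.inr (Or.inr (Or.inr (Or.inr (Or.inr (Or.inr (Or.inl hχ))))))
    · rcases Nat.lt_succ_iff_lt_or_eq.mp hj with hj | rfl
      · exact Or.inr (Or.inr (Or.inr (Or.inr (Or.inr (Or.inr (Or.inr ⟨j, hj, rfl⟩))))))
      · exact Or.inr (Or.inr (Or.inr (Or.inl rfl)))

/-- The number with binary digits `a 0, …, a (w - 1)`, from the least significant one on. -/
def bitsVal (w : ℕ) (a : ℕ → Bool) : ℕ := ∑ j ∈ Finset.range w, if a j then 2 ^ j else 0

theorem bitsVal_succ (w : ℕ) (a : ℕ → Bool) :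
    bitsVal (w + 1) a = bitsVal w a + if a w then 2 ^ w else 0 := Finset.sum_range_succ _ _

theorem bitsVal_congr {w : ℕ} {a b : ℕ → Bool} (h : ∀ j < w, a j = b j) :
    bitsVal w a = bitsVal w b :=
  Finset.sum_congr rfl fun j hj => by rw [h j (Finset.mem_range.mp hj)]

theorem bitsVal_lt (w : ℕ) (a : ℕ → Bool) : bitsVal w a < 2 ^ w := by
  induction w with
  | zero => simp [bitsVal]
  | succ w ih => rw [bitsVal_succ, pow_succ]; split_ifs <;> omega

/-- Together with an initial carry of 1, complementing the bits turns the adder into a subtractor.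
-/
theorem bitsVal_not (w : ℕ) (a : ℕ → Bool) : bitsVal w (fun j => !a j) + bitsVal w a + 1 = 2 ^ w := by
  induction w with
  | zero => simp [bitsVal]
  | succ w ih => rw [bitsVal_succ, bitsVal_succ, pow_succ]; cases a w <;> simp <;> omega

theorem bitsVal_sumBit (w : ℕ) (a b : ℕ → Bool) (c : Bool) :
    bitsVal w (sumBit a b c) + (if carryBit a b c w then 2 ^ w else 0) =
      bitsVal w a + bitsVal w b + if c then 1 else 0 := by
  induction w with
  | zero => simp [bitsVal, carryBit]
  | succ w ih =>
    rw [bitsVal_succ, bitsVal_succ, bitsVal_succ, pow_succ]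
    simp only [carryBit, show sumBit a b c w = ((a w ^^ b w) ^^ carryBit a b c w) from rfl]
    rcases Bool.eq_false_or_eq_true (carryBit a b c w) with hr | hr <;>
      rcases Bool.eq_false_or_eq_true (a w) with hu | hu <;>
      rcases Bool.eq_false_or_eq_true (b w) with hv | hv <;>
      simp [hr, hu, hv] at ih ⊢ <;> omega

end Circuits

/-! ### Finite binary expansions and truncation -/

section Classes

variable {X : Type*} {F : Set (X → unitInterval)} {s t : ℕ × ℕ} {S : Set (X → Bool)}

theorem BitsComputable.mem_simClass (hS : BitsComputable F s S) {m : ℕ} {c : Fin m → X → Bool}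
    (hc : ∀ j, c j ∈ S) {h : X → unitInterval} (hh : ∀ x, (h x : ℝ) = ofBits fun j => c j x) :
    h ∈ simClass F s := by
  obtain ⟨k, hk, f, hf, gates, hg, hS⟩ := hS
  choose w hw using fun j => hS _ (hc j)
  refine ⟨k, hk, f, hf, m, ⟨gates, w⟩, hg, fun x => (hh x).trans (congrArg ofBits ?_)⟩
  funext j
  simpa [Circuit.eval] using (hw j [] x).symm

/-- `u` is computed in binary with complexity `s` and with `m` digits. -/
def IsDigital (F : Set (X → unitInterval)) (s : ℕ × ℕ) (m : ℕ) (u : X → unitInterval) : Prop :=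
  ∃ c : ℕ → X → Bool, (∀ i, m ≤ i → c i = fun _ => false) ∧
    BitsComputable F s (Set.range c) ∧
      ∀ x, (u x : ℝ) = ∑ i ∈ Finset.range m, if c i x then ((1 : ℝ) / 2) ^ i else 0

theorem sum_digits_eq {c : ℕ → X → Bool} {m n : ℕ} (hc : ∀ i, m ≤ i → c i = fun _ => false)
    (hmn : m ≤ n) (x : X) :
    (∑ i ∈ Finset.range m, if c i x then ((1 : ℝ) / 2) ^ i else 0) =
      ∑ i ∈ Finset.range n, if c i x then ((1 : ℝ) / 2) ^ i else 0 := by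
  refine Finset.sum_subset (Finset.range_subset_range.mpr hmn) fun i _ hi => ?_
  rw [hc i (by simpa using hi)]
  simp

theorem IsDigital.mono {m n : ℕ} {u : X → unitInterval} (hu : IsDigital F s m u) (hst : s ≤ t)
    (hmn : m ≤ n) : IsDigital F t n u := by
  obtain ⟨c, hc, hC, hu⟩ := hu
  exact ⟨c, fun i hi => hc i (hmn.trans hi), hC.mono hst le_rfl,
    fun x => (hu x).trans (sum_digits_eq hc hmn x)⟩

theorem IsDigital.mem_simClass {m : ℕ} {u : X → unitInterval} (hu : IsDigital F s m u) :
    u ∈ simClass F s := by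
  obtain ⟨c, -, hC, hu⟩ := hu
  refine hC.mem_simClass (m := m) (c := fun j => c j) (fun j => ⟨j, rfl⟩) fun x => ?_
  rw [hu, ofBits, Fin.sum_univ_eq_sum_range (fun i => if c i x then ((1 : ℝ) / 2) ^ i else 0)]

theorem exists_isDigital {h : X → unitInterval} (hh : h ∈ simClass F s) :
    ∃ m, IsDigital F s m h := by
  obtain ⟨k, hk, f, hf, m, C, hC, hx⟩ := hh
  obtain ⟨es, hes, hw⟩ := exists_available_copy id
    (fun x i j => binaryDigit (f i x : ℝ) j) [] C.gates
  refine ⟨m, fun i => if hi : i < m then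
    fun x => C.eval (fun i j => binaryDigit (f i x : ℝ) j) ⟨i, hi⟩ else fun _ => false,
    fun i hi => dif_neg hi.not_gt, ⟨k, hk, f, hf, [] ++ es, ?_, ?_⟩, fun x => ?_⟩
  · rw [List.nil_append, hes]
    exact hC
  · rintro φ ⟨i, rfl⟩
    by_cases hi : i < m
    · simp only [dif_pos hi]
      exact hw (C.out ⟨i, hi⟩)
    · simpa only [dif_neg hi] using available_const _ _ false
  · rw [hx, ofBits, ← Fin.sum_univ_eq_sum_range]
    simp

/-- A new digit adds no more than the geometric tail loses; this controls the truncation error. -/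
theorem sum_digits_add_le (c : ℕ → Bool) (m n : ℕ) :
    (∑ i ∈ Finset.range (m + n), if c i then ((1 : ℝ) / 2) ^ i else 0) + 2 * (1 / 2) ^ (m + n) ≤
      (∑ i ∈ Finset.range m, if c i then ((1 : ℝ) / 2) ^ i else 0) + 2 * (1 / 2) ^ m := by
  induction n with
  | zero => rfl
  | succ n ih =>
    rw [← Nat.add_assoc, Finset.sum_range_succ, pow_succ]
    have : (0 : ℝ) < (1 / 2) ^ (m + n) := by positivity
    split_ifs <;> linarith

/-- Truncation after `m` digits. -/
theorem exists_truncation {f : X → unitInterval} (hf : f ∈ simClass F s) (m : ℕ) :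
    ∃ u, IsDigital F s m u ∧ ∀ x, (u x : ℝ) ≤ f x ∧ (f x : ℝ) ≤ u x + 2 * (1 / 2) ^ m := by
  obtain ⟨n, c, hc, hC, hf⟩ := exists_isDigital hf
  set v : X → ℝ := fun x => ∑ i ∈ Finset.range m, if c i x then ((1 : ℝ) / 2) ^ i else 0 with hv
  have hv0 : ∀ x, 0 ≤ v x := fun x => Finset.sum_nonneg fun i _ => by positivity
  have hvf : ∀ x, v x ≤ f x := fun x => by
    rw [hf, sum_digits_eq hc (Nat.le_add_left n m)]
    exact Finset.sum_le_sum_of_subset_of_nonneg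
      (Finset.range_subset_range.mpr (Nat.le_add_right m n)) fun i _ _ => by positivity
  refine ⟨fun x => ⟨v x, hv0 x, (hvf x).trans (f x).2.2⟩,
    ⟨fun i => if i < m then c i else fun _ => false, fun i hi => if_neg hi.not_gt,
      hC.const.mono le_rfl ?_, fun x => ?_⟩, fun x => ⟨hvf x, ?_⟩⟩
  · rintro φ ⟨i, rfl⟩
    by_cases hi : i < m
    · exact Or.inl ⟨i, (if_pos hi).symm⟩
    · exact Or.inr ⟨false, (if_neg hi).symm⟩
  · simp only [hv]
    refine Finset.sum_congr rfl fun i hi => ?_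
    simp only [if_pos (Finset.mem_range.mp hi)]
  · have h := sum_digits_add_le (fun i => c i x) m n
    have : (0 : ℝ) < (1 / 2) ^ (m + n) := by positivity
    rw [hf, sum_digits_eq hc (Nat.le_add_left n m)]
    simp only [hv]
    linarith

theorem simClass_mono (hst : s ≤ t) : simClass F s ⊆ simClass F t := fun _ ⟨k, hk, h⟩ => by
  obtain ⟨f, hf, m, C, hC, hx⟩ := h
  exact ⟨k, hk.trans hst.1, f, hf, m, C, hC.trans hst.2, hx⟩

end Classes

/-! ### Fixed-point arithmetic for boosting sums -/

section Boost

variable {X : Type*} {F : Set (X → unitInterval)} {s t : ℕ × ℕ} {a n : ℕ} {H : X → ℝ}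

/-- `H` arises from `1 / 2` by `n` boosting steps. Each of them adds or subtracts a function of
complexity `s` that has few digits, multiplied by a step size `2 ^ (-b)` with `b ≤ a`. -/
inductive IsBoost (F : Set (X → unitInterval)) (s : ℕ × ℕ) (a : ℕ) : ℕ → (X → ℝ) → Prop
  | zero : IsBoost F s a 0 fun _ => 1 / 2
  | step {n : ℕ} {H : X → ℝ} (hH : IsBoost F s a n H) {u : X → unitInterval}
      (hu : IsDigital F s (a + 3) u) {b : ℕ} (hb : b ≤ a) (σ : Bool) :
      IsBoost F s a (n + 1) fun x => H x + (if σ then -1 else 1) * ((1 / 2) ^ b * u x)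

theorem IsBoost.mono {a' : ℕ} (hH : IsBoost F s a n H) (hst : s ≤ t) (ha : a ≤ a') :
    IsBoost F t a' n H := by
  induction hH with
  | zero => exact .zero
  | step _ hu hb σ ih => exact ih.step (hu.mono hst (by omega)) (hb.trans ha) σ

theorem IsBoost.abs_sub_le (hH : IsBoost F s a n H) (x : X) : |H x - 1 / 2| ≤ n := by
  induction hH with
  | zero => simp
  | @step n H _ u _ b _ σ ih =>
    have h₀ : 0 ≤ (1 / 2 : ℝ) ^ b * u x := mul_nonneg (by positivity) (u x).2.1
    have h₁ : (1 / 2 : ℝ) ^ b * u x ≤ 1 :=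
      mul_le_one₀ (pow_le_one₀ (by norm_num) (by norm_num)) (u x).2.1 (u x).2.2
    rw [abs_le] at ih ⊢
    push_cast
    cases σ <;> simp only [if_true, if_false, Bool.false_eq_true] <;>
      constructor <;> linarith [ih.1, ih.2]

theorem cast_bitsVal (p : ℕ) (c : ℕ → Bool) :
    (bitsVal p c : ℝ) =
      ∑ i ∈ Finset.range p, if c (p - 1 - i) then (2 : ℝ) ^ p * (1 / 2) ^ (i + 1) else 0 := by
  rw [bitsVal, ← Finset.sum_range_reflect]
  push_cast
  refine Finset.sum_congr rfl fun i hi => ?_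
  have : (2 : ℝ) ^ p = 2 ^ (p - 1 - i) * 2 ^ (i + 1) := by
    rw [← pow_add]; congr 1; have := Finset.mem_range.mp hi; omega
  rw [this, mul_assoc, ← mul_pow]
  norm_num

theorem bitsVal_eq_of_le {v w : ℕ} (hvw : v ≤ w) {c : ℕ → Bool}
    (hc : ∀ j, v ≤ j → j < w → c j = false) : bitsVal w c = bitsVal v c := by
  refine (Finset.sum_subset (Finset.range_subset_range.mpr hvw) fun i hi hi' => ?_).symm
  rw [hc i (by simpa using hi') (by simpa using hi)]
  simp

theorem pow_le_bitsVal {j w : ℕ} (hj : j < w) {c : ℕ → Bool} (hc : c j = true) :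
    2 ^ j ≤ bitsVal w c := by
  have := Finset.single_le_sum (f := fun j => if c j then 2 ^ j else 0) (fun i _ => Nat.zero_le _)
    (Finset.mem_range.mpr hj)
  simpa [hc, bitsVal] using this

/-- The multiple `2 ^ N * u` of a function with at most `N + 1` digits, as an integer in binary. -/
theorem IsDigital.exists_bits {m N w : ℕ} {u : X → unitInterval} (hu : IsDigital F s m u)
    (hm : m ≤ N + 1) (hw : N < w) :
    ∃ B : ℕ → X → Bool, BitsComputable F s (Set.range B) ∧
      ∀ x, (bitsVal w fun j => B j x : ℝ) = 2 ^ N * u x := by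
  obtain ⟨c, hc, hC, hu⟩ := hu
  refine ⟨fun j => if j ≤ N then c (N - j) else fun _ => false, hC.const.mono le_rfl ?_,
    fun x => ?_⟩
  · rintro φ ⟨j, rfl⟩
    by_cases hj : j ≤ N
    · exact Or.inl ⟨N - j, (if_pos hj).symm⟩
    · exact Or.inr ⟨false, (if_neg hj).symm⟩
  · rw [bitsVal_eq_of_le (v := N + 1) hw (fun j hj _ => by
      simp only [if_neg (show ¬ j ≤ N by omega)]), cast_bitsVal,
      hu, sum_digits_eq hc hm, Finset.mul_sum]
    refine Finset.sum_congr rfl fun i hi => ?_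
    have hi := Finset.mem_range.mp hi
    simp only [if_pos (show N + 1 - 1 - i ≤ N by omega), show N - (N + 1 - 1 - i) = i by omega]
    split_ifs
    · rw [pow_succ, pow_succ]; ring
    · simp

/-- The last digit of u has weight 2^(-(a+2)) and the step size shifts it by at most a places, so
2a+2 fractional digits are exact. The offset 2^(4a+3) makes the top bit a sign. Working modulo
2^(4a+4) postpones all overflow questions. With w = 4a+4, a step costs w gates for the conditional
complement and 5w for the adder. -/
theorem IsBoost.exists_bits (hH : IsBoost F s a n H) :
    ∃ A : ℕ → X → Bool,
      BitsComputable F (n • s + (0, n * (6 * (4 * a + 4)))) (Set.range A) ∧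
      ∀ x, ∃ Z k : ℤ, (Z : ℝ) = 2 ^ (2 * a + 2) * H x ∧
        (bitsVal (4 * a + 4) fun j => A j x : ℤ) = 2 ^ (4 * a + 3) + Z + 2 ^ (4 * a + 4) * k := by
  induction hH with
  | zero =>
    -- Bit 4a+3 is the offset, and bit 2a+1 represents 1/2.
    refine ⟨fun j _ => decide (j = 4 * a + 3 ∨ j = 2 * a + 1),
      (bitsComputable_empty (s := 0 • s + (0, 0 * (6 * (4 * a + 4))))).const.mono le_rfl ?_,
      fun x => ⟨2 ^ (2 * a + 1), 0, ?_, ?_⟩⟩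
    · rintro φ ⟨j, rfl⟩
      exact Or.inr ⟨_, rfl⟩
    · push_cast; ring
    · rw [bitsVal_succ, bitsVal_eq_of_le (v := 2 * a + 2) (by omega), bitsVal_succ,
        bitsVal_eq_of_le (v := 0) (by omega)]
      · simp [bitsVal]; ring
      · intro j _ hj; simp; omega
      · intro j _ hj; simp; omega
  | @step n H _ u hu b hb σ ih =>
    obtain ⟨A, hA, hAx⟩ := ih
    set w := 4 * a + 4 with hw
    -- The factor 2^(-b) is a shift and costs no gates.
    obtain ⟨B, hB, hBx⟩ := hu.exists_bits (N := 2 * a + 2 - b) (w := w) (by omega) (by omega)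
    have h₁ := hA.union hB.const
    have h₂ := (h₁.gates (φ := B) (ψ := B) (fun j => Or.inr (Or.inl ⟨j, rfl⟩))
      (fun j => Or.inr (Or.inl ⟨j, rfl⟩)) (fun y _ => y ^^ σ) w)
    have h₃ := h₂.adder (a := A)
      (b := fun j => if j < w then fun x => B j x ^^ σ else fun _ => false)
      (fun j => Or.inl (Or.inl ⟨j, rfl⟩)) (fun j => by
        by_cases hj : j < w
        · rw [if_pos hj]; exact Or.inr ⟨j, hj, rfl⟩
        · rw [if_neg hj]; exact Or.inl (Or.inr (Or.inr ⟨false, rfl⟩))) σ w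
    set B' : ℕ → X → Bool := fun j => if j < w then fun x => B j x ^^ σ else fun _ => false with hB'
    refine ⟨fun j => if j < w then fun x => sumBit (fun j => A j x) (fun j => B' j x) σ j
      else fun _ => false, h₃.const.mono (le_of_eq ?_) ?_, fun x => ?_⟩
    · ext
      · simp; ring
      · simp; ring
    · rintro φ ⟨j, rfl⟩
      by_cases hj : j < w
      · simp only [if_pos hj]
        exact Or.inl (Or.inr (Or.inr ⟨j, hj, rfl⟩))
      · simp only [if_neg hj]
        exact Or.inr ⟨false, rfl⟩
    · obtain ⟨Z, k, hZ, hk⟩ := hAx x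
      have hadd := bitsVal_sumBit w (fun j => A j x) (fun j => B' j x) σ
      have hcongr : bitsVal w (fun j => (if j < w then
          fun x => sumBit (fun j => A j x) (fun j => B' j x) σ j else fun _ => false) x) =
          bitsVal w (sumBit (fun j => A j x) (fun j => B' j x) σ) :=
        bitsVal_congr fun j hj => by rw [if_pos hj]
      have hcongr' : bitsVal w (fun j => B' j x) = bitsVal w (fun j => B j x ^^ σ) :=
        bitsVal_congr fun j hj => by simp only [hB', if_pos hj]
      rw [hcongr'] at hadd
      rw [hcongr]
      have hnot := bitsVal_not w (fun j => B j x)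
      have hBr : (2 : ℝ) ^ (2 * a + 2) * ((1 / 2) ^ b * u x) = (bitsVal w fun j => B j x : ℕ) := by
        rw [hBx, ← mul_assoc]
        congr 1
        rw [show 2 * a + 2 = (2 * a + 2 - b) + b by omega, pow_add, mul_assoc, ← mul_pow]
        norm_num
      zify at hadd hnot
      cases σ
      · refine ⟨Z + bitsVal w fun j => B j x,
          k - if carryBit (fun j => A j x) (fun j => B' j x) false w then 1 else 0, ?_, ?_⟩
        · push_cast
          rw [hZ, ← hBr]
          simp; ring
        · simp only [Bool.xor_false, Bool.false_eq_true, if_false] at hadd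
          split_ifs at hadd ⊢ <;> linarith
      -- Complement plus one represents 2^w - B, hence the extra 1 in the multiple of the modulus.
      · refine ⟨Z - bitsVal w fun j => B j x,
          k + 1 - if carryBit (fun j => A j x) (fun j => B' j x) true w then 1 else 0, ?_, ?_⟩
        · push_cast
          rw [hZ, ← hBr]
          simp; ring
        · simp only [Bool.xor_true, if_true] at hadd
          split_ifs at hadd ⊢ <;> linarith

/-- The projection of a real number to `[0, 1]`. -/
noncomputable def clip (y : ℝ) : unitInterval := Set.projIcc 0 1 zero_le_one y

theorem coe_clip (y : ℝ) : (clip y : ℝ) = max 0 (min 1 y) := rfl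

/-- The bound on n rules out wraparound. The top bit then tells whether H ≥ 0; if so, some bit among
2a+2, …, 4a+2 is set exactly when H ≥ 1, and otherwise the lower bits are the fractional digits of
H. -/
theorem IsBoost.clip_mem (hH : IsBoost F s a n H) (hn : n ≤ 2 ^ (2 * a)) :
    (fun x => clip (H x)) ∈ simClass F (n • s + (0, (6 * n + 2) * (4 * a + 4))) := by
  obtain ⟨A, hA, hAx⟩ := hH.exists_bits
  have h₁ := hA.anyBit (a := fun j => A (2 * a + 2 + j)) (fun j => ⟨_, rfl⟩) (2 * a + 1)
  have h₂ := h₁.gate (Or.inr ⟨4 * a + 3, rfl⟩) (Or.inl rfl) and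
  have h₃ := h₂.gate (Or.inr (Or.inr ⟨4 * a + 3, rfl⟩)) (Or.inr (Or.inl rfl)) fun y z => y && !z
  have h₄ := h₃.gates (φ := fun _ => _) (ψ := A) (fun j => Or.inl rfl)
    (fun j => Or.inr (Or.inr (Or.inr ⟨j, rfl⟩))) and (2 * a + 2)
  refine (h₄.mono (t := n • s + (0, (6 * n + 2) * (4 * a + 4))) ?_ le_rfl).mem_simClass
    (m := 2 * a + 3) (c := Fin.cons (fun x => A (4 * a + 3) x &&
      anyBit (fun j => A (2 * a + 2 + j) x) (2 * a + 1)) fun i x => (A (4 * a + 3) x &&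
      !anyBit (fun j => A (2 * a + 2 + j) x) (2 * a + 1)) && A (2 * a + 2 - 1 - i) x) ?_ ?_
  · constructor
    · simp
    · simp only [Prod.snd_add, Prod.smul_snd]
      nlinarith
  · refine Fin.cases ?_ fun i => ?_
    · exact Or.inl (Or.inr (Or.inl rfl))
    · exact Or.inr ⟨2 * a + 2 - 1 - i, by simp; omega, rfl⟩
  · intro x
    obtain ⟨Z, k, hZ, hk⟩ := hAx x
    have habs := abs_le.mp (hH.abs_sub_le x)
    have hn' : (n : ℝ) ≤ 2 ^ (2 * a) := by exact_mod_cast hn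
    have hq : (2 : ℝ) ^ (4 * a + 3) = 2 ^ (2 * a + 2) * (2 * 2 ^ (2 * a)) := by ring
    have hp : (0 : ℝ) < 2 ^ (2 * a + 2) := by positivity
    have hone : (1 : ℝ) ≤ 2 ^ (2 * a) := one_le_pow₀ (by norm_num)
    have hZlt : Z < 2 ^ (4 * a + 3) := by
      have : (Z : ℝ) < 2 ^ (4 * a + 3) := by
        rw [hZ, hq]; exact mul_lt_mul_of_pos_left (by linarith) hp
      exact_mod_cast this
    have hZge : -2 ^ (4 * a + 3) ≤ Z := by
      have : -(2 : ℝ) ^ (4 * a + 3) ≤ Z := by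
        rw [hZ, hq, ← mul_neg]; exact mul_le_mul_of_nonneg_left (by linarith) hp.le
      exact_mod_cast this
    have hlt : (bitsVal (4 * a + 4) fun j => A j x : ℤ) < 2 ^ (4 * a + 4) := by
      exact_mod_cast bitsVal_lt _ _
    have hge : (0 : ℤ) ≤ (bitsVal (4 * a + 4) fun j => A j x) := Int.natCast_nonneg _
    have hw : (2 : ℤ) ^ (4 * a + 4) = 2 * 2 ^ (4 * a + 3) := by ring
    have hwpos : (0 : ℤ) < 2 ^ (4 * a + 3) := by positivity
    -- Both the register and 2^(4a+3) + Z lie in [0, 2^(4a+4)).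
    have hk0 : k = 0 := by
      have h1 : k < 1 := by nlinarith
      have h2 : -1 < k := by nlinarith
      omega
    rw [hk0, mul_zero, add_zero, bitsVal_succ] at hk
    have hH' : H x = Z / 2 ^ (2 * a + 2) := by rw [hZ]; field_simp
    rw [ofBits, Fin.sum_univ_succ]
    simp only [Fin.cons_zero, Fin.cons_succ, Fin.val_zero, Fin.val_succ, pow_zero]
    rw [Fin.sum_univ_eq_sum_range (fun i => if ((A (4 * a + 3) x &&
      !anyBit (fun j => A (2 * a + 2 + j) x) (2 * a + 1)) && A (2 * a + 2 - 1 - i) x) = true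
      then ((1 : ℝ) / 2) ^ (i + 1) else 0)]
    cases htop : A (4 * a + 3) x
    · have hlow := bitsVal_lt (4 * a + 3) fun j => A j x
      zify at hlow
      have hneg : (Z : ℝ) < 0 := by
        have : Z < 0 := by simp [htop] at hk; linarith
        exact_mod_cast this
      have : H x < 0 := by rw [hH']; exact div_neg_of_neg_of_pos hneg hp
      simp [coe_clip, this.le]
    · have hZ' : Z = (bitsVal (4 * a + 3) fun j => A j x : ℕ) := by
        simp [htop] at hk; linarith
      cases hany : anyBit (fun j => A (2 * a + 2 + j) x) (2 * a + 1)
      · have hany' := anyBit_eq_false.mp hany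
        rw [bitsVal_eq_of_le (v := 2 * a + 2) (by omega) (fun j hj hj' => by
          have := hany' (j - (2 * a + 2)) (by omega)
          rwa [Nat.add_sub_cancel' hj] at this)] at hZ'
        have hlow := bitsVal_lt (2 * a + 2) fun j => A j x
        have h0 : 0 ≤ H x := by rw [hH', hZ']; positivity
        have h1 : H x ≤ 1 := by
          rw [hH', hZ', div_le_one hp]
          exact_mod_cast hlow.le
        rw [coe_clip, min_eq_right h1, max_eq_right h0, hH', hZ', Int.cast_natCast, cast_bitsVal,
          Finset.sum_div]
        simp only [Bool.and_false, Bool.not_false, Bool.and_true, Bool.true_and,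
          Bool.false_eq_true, if_false, zero_add]
        refine Finset.sum_congr rfl fun i _ => ?_
        split_ifs
        · field_simp
        · simp
      · obtain ⟨j, hj, hj'⟩ : ∃ j < 2 * a + 1, A (2 * a + 2 + j) x = true := by
          by_contra! hcon
          rw [anyBit_eq_false.mpr fun j hj => by simpa using hcon j hj] at hany
          exact Bool.noConfusion hany
        have hle : 2 ^ (2 * a + 2) ≤ bitsVal (4 * a + 3) fun j => A j x :=
          (Nat.pow_le_pow_right (by norm_num) (Nat.le_add_right _ j)).trans
            (pow_le_bitsVal (c := fun j => A j x) (by omega) hj')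
        have h1 : 1 ≤ H x := by
          rw [hH', hZ', one_le_div hp]
          exact_mod_cast hle
        simp [coe_clip, h1]

end Boost

/-! ### Expectations -/

section Expectation

variable {X : Type*} [Fintype X] {D : X → ℝ}

theorem expect_add (φ ψ : X → ℝ) :
    (expect D fun x => φ x + ψ x) = expect D φ + expect D ψ := by
  simp [expect, mul_add, Finset.sum_add_distrib]

theorem expect_const_mul (r : ℝ) (φ : X → ℝ) : (expect D fun x => r * φ x) = r * expect D φ := by
  rw [expect, expect, Finset.mul_sum]
  exact Finset.sum_congr rfl fun x _ => by ring

theorem expect_const (hD : D ∈ stdSimplex ℝ X) (r : ℝ) : (expect D fun _ => r) = r := by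
  rw [expect, ← Finset.sum_mul, hD.2, one_mul]

theorem expect_mono (hD : D ∈ stdSimplex ℝ X) {φ ψ : X → ℝ} (h : ∀ x, φ x ≤ ψ x) :
    expect D φ ≤ expect D ψ :=
  Finset.sum_le_sum fun x _ => mul_le_mul_of_nonneg_left (h x) (hD.1 x)

theorem abs_expect_le (hD : D ∈ stdSimplex ℝ X) {φ : X → ℝ} {r : ℝ} (h : ∀ x, |φ x| ≤ r) :
    |expect D φ| ≤ r := by
  rw [abs_le]
  constructor
  · rw [← expect_const hD (-r)]
    exact expect_mono hD fun x => (abs_le.mp (h x)).1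
  · rw [← expect_const hD r]
    exact expect_mono hD fun x => (abs_le.mp (h x)).2

theorem sq_expect_le (hD : D ∈ stdSimplex ℝ X) (φ : X → ℝ) :
    expect D φ ^ 2 ≤ expect D fun x => φ x ^ 2 := by
  have h : (expect D fun x => 2 * expect D φ * φ x + -(expect D φ) ^ 2) ≤
      expect D fun x => φ x ^ 2 :=
    expect_mono hD fun x => by nlinarith [sq_nonneg (φ x - expect D φ)]
  rw [expect_add, expect_const_mul, expect_const hD] at h
  linarith

end Expectation

/-! ### The energy and its decrease under boosting -/

section Energy

/-- Twice the Bregman divergence of `g` from the unclipped prediction `y`. -/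
noncomputable def pointEnergy (g y : ℝ) : ℝ :=
  ((clip y : ℝ) - g) ^ 2 + 2 * (y - clip y) * (clip y - g)

theorem clip_cases (y : ℝ) :
    (y ≤ 0 ∧ (clip y : ℝ) = 0) ∨ (0 ≤ y ∧ y ≤ 1 ∧ (clip y : ℝ) = y) ∨
      (1 ≤ y ∧ (clip y : ℝ) = 1) := by
  rcases le_total y 0 with h | h
  · exact Or.inl ⟨h, by simp [coe_clip, h]⟩
  · rcases le_total y 1 with h' | h'
    · exact Or.inr (Or.inl ⟨h, h', by simp [coe_clip, h, h']⟩)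
    · exact Or.inr (Or.inr ⟨h', by simp [coe_clip, h']⟩)

theorem pointEnergy_nonneg (g : unitInterval) (y : ℝ) : 0 ≤ pointEnergy g y := by
  have h0 := g.2.1
  have h1 := g.2.2
  rw [pointEnergy]
  rcases clip_cases y with ⟨h, e⟩ | ⟨-, -, e⟩ | ⟨h, e⟩ <;> rw [e]
  · nlinarith
  · nlinarith [sq_nonneg (y - g)]
  · nlinarith

/-- With Φ' = `clip`, the terms in g cancel and leave Φ(y) - Φ(y') - Φ'(y')(y - y') ≥ (Φ'(y) -
Φ'(y'))²/2, which holds for convex Φ with 1-Lipschitz derivative. -/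
theorem pointEnergy_sub_ge (g y y' : ℝ) :
    ((clip y : ℝ) - clip y') ^ 2 + 2 * ((g - clip y') * (y' - y)) ≤
      pointEnergy g y - pointEnergy g y' := by
  rw [pointEnergy, pointEnergy]
  rcases clip_cases y with ⟨h, e⟩ | ⟨h, h₁, e⟩ | ⟨h, e⟩ <;>
    rcases clip_cases y' with ⟨h', e'⟩ | ⟨h', h₁', e'⟩ | ⟨h', e'⟩ <;> rw [e, e'] <;> nlinarith

/-- The quadratic upper bound for a function of y whose derivative 2(clip y - g) is 2-Lipschitz. -/
theorem pointEnergy_add_le (g y d : ℝ) :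
    pointEnergy g (y + d) ≤ pointEnergy g y + -2 * (d * (g - clip y)) + d ^ 2 := by
  obtain ⟨z, rfl⟩ : ∃ z, d = z - y := ⟨y + d, by ring⟩
  rw [add_sub_cancel, pointEnergy, pointEnergy]
  rcases clip_cases y with ⟨h, e⟩ | ⟨h, h₁, e⟩ | ⟨h, e⟩ <;>
    rcases clip_cases z with ⟨h', e'⟩ | ⟨h', h₁', e'⟩ | ⟨h', e'⟩ <;> rw [e, e'] <;>
    nlinarith [sq_nonneg (z - y), sq_nonneg z, sq_nonneg y, sq_nonneg (y - 1), sq_nonneg (z - 1)]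

variable {X : Type*} [Fintype X] {D : X → ℝ} {F : Set (X → unitInterval)} {g : X → unitInterval}

/-- The potential that decreases in every boosting step. -/
noncomputable def energy (D : X → ℝ) (g : X → unitInterval) (H : X → ℝ) : ℝ :=
  expect D fun x => pointEnergy (g x) (H x)

theorem energy_nonneg (hD : D ∈ stdSimplex ℝ X) (H : X → ℝ) : 0 ≤ energy D g H := by
  rw [← expect_const hD 0]
  exact expect_mono hD fun x => pointEnergy_nonneg _ _

theorem energy_half_le (hD : D ∈ stdSimplex ℝ X) : energy D g (fun _ => 1 / 2) ≤ 1 / 4 := by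
  rw [← expect_const hD (1 / 4)]
  refine expect_mono hD fun x => ?_
  have h0 := (g x).2.1
  have h1 := (g x).2.2
  rw [pointEnergy, coe_clip]
  norm_num
  nlinarith

theorem expect_sq_sub_le (hD : D ∈ stdSimplex ℝ X) (H H' : X → ℝ) :
    (expect D fun x => ((clip (H x) : ℝ) - clip (H' x)) ^ 2) +
      2 * (expect D fun x => ((g x : ℝ) - clip (H' x)) * (H' x - H x)) ≤
      energy D g H - energy D g H' := by
  have h := expect_mono hD fun x => pointEnergy_sub_ge (g x) (H x) (H' x)
  have e : (expect D fun x => pointEnergy (g x) (H x) - pointEnergy (g x) (H' x)) =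
      energy D g H - energy D g H' := by
    simp [expect, energy, mul_sub, Finset.sum_sub_distrib]
  rw [expect_add, expect_const_mul] at h
  linarith

/-- If the current prediction is not regular, then a boosting step decreases the energy. -/
theorem exists_boost_step (hD : D ∈ stdSimplex ℝ X) {s : ℕ × ℕ} {a : ℕ} {e : ℝ}
    (hle : (1 / 2 : ℝ) ^ a ≤ e / 4) {H : X → ℝ}
    (hH : ¬ IsRegular D (simClass F s) e g fun x => clip (H x)) :
    ∃ u, IsDigital F s (a + 3) u ∧ ∃ σ : Bool,
      energy D g (fun x => H x + (if σ then -1 else 1) * ((1 / 2) ^ a * u x)) +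
        13 / 8 * ((1 / 2) ^ a * e) ≤ energy D g H := by
  rw [IsRegular] at hH
  push Not at hH
  obtain ⟨f, hf, hfe⟩ := hH
  obtain ⟨u, hu, huf⟩ := exists_truncation hf (a + 3)
  have hδ : (0 : ℝ) < (1 / 2) ^ a := by positivity
  generalize hδe : (1 / 2 : ℝ) ^ a = δ at *
  have hpow : 2 * (1 / 2 : ℝ) ^ (a + 3) = δ / 4 := by rw [pow_add, hδe]; ring
  set r := expect D fun x => (u x : ℝ) * ((g x : ℝ) - clip (H x)) with hr
  -- Truncating the test costs at most δ/4 ≤ e/16.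
  have habs : 15 / 16 * e ≤ |r| := by
    have hsplit : (expect D fun x => (f x : ℝ) * ((g x : ℝ) - clip (H x))) =
        r + expect D fun x => ((f x : ℝ) - u x) * ((g x : ℝ) - clip (H x)) := by
      rw [hr, ← expect_add]
      congr 1
      funext x
      ring
    have hsmall : |expect D fun x => ((f x : ℝ) - u x) * ((g x : ℝ) - clip (H x))| ≤ e / 16 := by
      refine abs_expect_le hD fun x => ?_
      rw [abs_mul]
      have h₁ : |(f x : ℝ) - u x| ≤ e / 16 := by
        have := huf x
        rw [abs_le]; constructor <;> linarith
      have h₂ : |(g x : ℝ) - clip (H x)| ≤ 1 := by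
        rw [abs_le]; constructor <;> linarith [(g x).2.1, (g x).2.2, (clip (H x)).2.1,
          (clip (H x)).2.2]
      calc _ ≤ e / 16 * 1 := mul_le_mul h₁ h₂ (abs_nonneg _) ((abs_nonneg _).trans h₁)
        _ = _ := mul_one _
    rw [hsplit] at hfe
    linarith [abs_add_le r (expect D fun x => ((f x : ℝ) - u x) * ((g x : ℝ) - clip (H x)))]
  obtain ⟨σ, hσ⟩ : ∃ σ : Bool, (if σ then -1 else 1) * r = |r| := by
    rcases le_total 0 r with h | h
    · exact ⟨false, by simp [abs_of_nonneg h]⟩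
    · exact ⟨true, by simp [abs_of_nonpos h]⟩
  refine ⟨u, hu, σ, ?_⟩
  have hσ2 : (if σ then (-1 : ℝ) else 1) ^ 2 = 1 := by cases σ <;> simp
  generalize (if σ then (-1 : ℝ) else 1) = ς at *
  have hstep : energy D g (fun x => H x + ς * (δ * u x)) ≤
      expect D fun x => pointEnergy (g x) (H x) +
        -2 * (ς * δ) * (u x * ((g x : ℝ) - clip (H x))) + δ ^ 2 := by
    refine expect_mono hD fun x => (pointEnergy_add_le _ _ _).trans ?_
    have hu1 : (u x : ℝ) ^ 2 ≤ 1 := pow_le_one₀ (u x).2.1 (u x).2.2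
    have : (ς * (δ * u x)) ^ 2 ≤ δ ^ 2 := by
      rw [mul_pow, hσ2, one_mul, mul_pow]
      exact mul_le_of_le_one_right (sq_nonneg δ) hu1
    linarith
  rw [expect_add, expect_add, expect_const_mul, expect_const hD, ← hr,
    show -2 * (ς * δ) * r = -2 * δ * (ς * r) by ring, hσ] at hstep
  have : energy D g H = expect D fun x => pointEnergy (g x) (H x) := rfl
  -- The gain is at least 2δ(15e/16) - δ² ≥ (15/8 - 1/4)δe, using δ ≤ e/4.
  nlinarith

/-- Boosting can be continued until the prediction is regular. -/
theorem exists_regular_boost (hD : D ∈ stdSimplex ℝ X) {s : ℕ × ℕ} {a n₀ : ℕ} {e : ℝ}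
    (he : 0 < e) (hle : (1 / 2 : ℝ) ^ a ≤ e / 4) {H₀ : X → ℝ} (hH₀ : IsBoost F s a n₀ H₀) :
    ∃ n H, IsBoost F s a (n₀ + n) H ∧
      energy D g H + 13 / 8 * (n * ((1 / 2) ^ a * e)) ≤ energy D g H₀ ∧
      IsRegular D (simClass F s) e g (fun x => clip (H x)) ∧
      |expect D fun x => ((g x : ℝ) - clip (H x)) * (H x - H₀ x)| ≤ n * ((1 / 2) ^ a * e) := by
  have hδ : (0 : ℝ) < (1 / 2) ^ a := by positivity
  by_contra! hcon
  -- The residual of the final prediction is unknown while the steps are taken, so the cross term is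
  -- bounded for every φ weakly correlated with the class.
  have key : ∀ n : ℕ, ∃ H, IsBoost F s a (n₀ + n) H ∧
      energy D g H + 13 / 8 * (n * ((1 / 2) ^ a * e)) ≤ energy D g H₀ ∧
      ∀ φ : X → ℝ, (∀ u ∈ simClass F s, |expect D fun x => (u x : ℝ) * φ x| ≤ e) →
        |expect D fun x => φ x * (H x - H₀ x)| ≤ n * ((1 / 2) ^ a * e) := by
    intro n
    induction n with
    | zero => exact ⟨H₀, hH₀, by simp, fun φ _ => by simp [expect]⟩
    | succ n ih =>
      obtain ⟨H, hH, henergy, hφ⟩ := ih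
      obtain ⟨u, hu, σ, hdrop⟩ := exists_boost_step hD hle fun hreg =>
        (hcon n H hH henergy hreg).not_ge (hφ _ hreg)
      refine ⟨_, hH.step hu le_rfl σ, ?_, fun φ h => ?_⟩
      · push_cast
        linarith
      · have hsplit : (expect D fun x => φ x *
            (H x + (if σ then -1 else 1) * ((1 / 2) ^ a * (u x : ℝ)) - H₀ x)) =
            (expect D fun x => φ x * (H x - H₀ x)) +
              (if σ then -1 else 1) * (1 / 2) ^ a * expect D fun x => (u x : ℝ) * φ x := by
          rw [← expect_const_mul, ← expect_add]
          congr 1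
          funext x
          ring
        have hterm : |(if σ then -1 else 1) * (1 / 2) ^ a * expect D fun x => (u x : ℝ) * φ x| ≤
            (1 / 2) ^ a * e := by
          rw [abs_mul, abs_mul, abs_of_pos hδ,
            show |(if σ then (-1 : ℝ) else 1)| = 1 by cases σ <;> simp, one_mul]
          exact mul_le_mul_of_nonneg_left (h u hu.mem_simClass) hδ.le
        rw [hsplit]
        push_cast
        linarith [abs_add_le (expect D fun x => φ x * (H x - H₀ x))
          ((if σ then -1 else 1) * (1 / 2) ^ a * expect D fun x => (u x : ℝ) * φ x), hφ φ h]
  -- Boosting forever would make the energy negative.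
  obtain ⟨n, hn⟩ := exists_nat_gt (energy D g H₀ / ((1 / 2) ^ a * e))
  rw [div_lt_iff₀ (by positivity)] at hn
  obtain ⟨H, -, hH, -⟩ := key n
  have := energy_nonneg (g := g) hD H
  have : 0 < (n : ℝ) * ((1 / 2) ^ a * e) := (energy_nonneg hD H₀).trans_lt hn
  linarith

end Energy

/-! ### Step sizes and size bounds -/

section Sizes

/-- The exponent `a` of a step size `2 ^ (-a)` that is comparable with the error `e`. -/
noncomputable def stepExponent (e : ℝ) : ℕ := Nat.clog 2 ⌈4 / e⌉₊

theorem half_pow_stepExponent_le {e : ℝ} (he : 0 < e) : (1 / 2 : ℝ) ^ stepExponent e ≤ e / 4 := by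
  have h : 4 / e ≤ 2 ^ stepExponent e :=
    (Nat.le_ceil _).trans (by exact_mod_cast Nat.le_pow_clog (by norm_num) _)
  rw [one_div_pow, one_div_le (by positivity) (by positivity), one_div_div]
  exact h

theorem two_pow_stepExponent_lt {e : ℝ} (he : 0 < e) (he' : e < 1 / 2) :
    (2 : ℝ) ^ stepExponent e < 8 / e := by
  have h4 : 8 < 4 / e := by rw [lt_div_iff₀ he]; linarith
  have hceil : 1 < ⌈4 / e⌉₊ := Nat.lt_ceil.mpr (by push_cast; linarith)
  have hpos : 0 < stepExponent e := Nat.clog_pos (by norm_num) hceil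
  have h := Nat.lt_ceil.mp (Nat.pow_pred_clog_lt_self (b := 2) (by norm_num) hceil)
  have h' : (2 : ℝ) ^ (stepExponent e - 1) < 4 / e := by exact_mod_cast h
  obtain ⟨a, ha⟩ := Nat.exists_eq_succ_of_ne_zero hpos.ne'
  rw [ha, Nat.succ_sub_one] at h'
  rw [ha, pow_succ, show 8 / e = 4 / e * 2 by ring]
  linarith

theorem lt_half_pow_stepExponent {e : ℝ} (he : 0 < e) (he' : e < 1 / 2) :
    e / 8 < (1 / 2 : ℝ) ^ stepExponent e := by
  rw [one_div_pow, lt_one_div (by positivity) (by positivity), one_div_div]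
  exact two_pow_stepExponent_lt he he'

theorem stepExponent_anti {e e' : ℝ} (he : 0 < e) (hee : e ≤ e') :
    stepExponent e' ≤ stepExponent e :=
  Nat.clog_mono_right 2 (Nat.ceil_mono (div_le_div_of_nonneg_left (by norm_num) he hee))

/-- From 2^a < 8/e and log 2 < log(1/e) follows 4a + 4 < (20 / log 2) log(1/e), and 20 / log 2 < 29.
-/
theorem stepExponent_le_log {e : ℝ} (he : 0 < e) (he' : e < 1 / 2) :
    (4 * stepExponent e + 4 : ℝ) ≤ 29 * Real.log (1 / e) := by
  have h := Real.log_lt_log (by positivity) (two_pow_stepExponent_lt he he')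
  rw [Real.log_pow, show 8 / e = 2 ^ 3 * (1 / e) by ring,
    Real.log_mul (by norm_num) (by positivity), Real.log_pow] at h
  have hL : Real.log 2 < Real.log (1 / e) :=
    Real.log_lt_log (by norm_num) ((lt_one_div (by norm_num) he).mpr he')
  have h2 := Real.log_two_gt_d9
  push_cast at h
  have hA : (0 : ℝ) ≤ stepExponent e := Nat.cast_nonneg _
  nlinarith

theorem gate_count_le {e : ℝ} (he : 0 < e) (he' : e < 1 / 2) {n : ℕ} (hn : n * e ^ 2 ≤ 2) :
    (6 * n + 2) * (4 * stepExponent e + 4) ≤ ⌈400 / e ^ 3 * Real.log (1 / e) ^ 1⌉₊ := by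
  have h := stepExponent_le_log he he'
  have hL : 0 < Real.log (1 / e) := Real.log_pos ((one_lt_div he).mpr (by linarith))
  have hcount : ((6 * n + 2 : ℕ) : ℝ) ≤ 13 / e ^ 3 := by
    rw [le_div_iff₀ (by positivity)]
    push_cast
    have h3 : e ^ 3 ≤ 1 / 8 := (pow_le_pow_left₀ he.le he'.le 3).trans (by norm_num)
    have : n * e ^ 3 ≤ 1 := by
      calc n * e ^ 3 = n * e ^ 2 * e := by ring
        _ ≤ 2 * e := mul_le_mul_of_nonneg_right hn he.le
        _ ≤ 1 := by linarith
    linarith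
  have hreal : (((6 * n + 2) * (4 * stepExponent e + 4) : ℕ) : ℝ) ≤
      400 / e ^ 3 * Real.log (1 / e) ^ 1 := by
    calc (((6 * n + 2) * (4 * stepExponent e + 4) : ℕ) : ℝ)
        = ((6 * n + 2 : ℕ) : ℝ) * (4 * stepExponent e + 4) := by push_cast; ring
      _ ≤ 13 / e ^ 3 * (29 * Real.log (1 / e)) :=
          mul_le_mul hcount h (by positivity) (by positivity)
      _ = 377 / e ^ 3 * Real.log (1 / e) ^ 1 := by ring
      _ ≤ 400 / e ^ 3 * Real.log (1 / e) ^ 1 := by gcongr; norm_num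
  exact_mod_cast hreal.trans (Nat.le_ceil _)

/-- One step of the recursion for the size bounds. -/
noncomputable def sizeStep (ε : ℕ × ℕ → ℝ) (G : ℕ × ℕ → ℕ × ℕ) (S : ℕ × ℕ) : ℕ × ℕ :=
  ⌈400 / ε S ^ 2⌉₊ • G S + (0, ⌈400 / ε S ^ 3 * Real.log (1 / ε S) ^ 1⌉₊)

variable {ε : ℕ × ℕ → ℝ} {G : ℕ × ℕ → ℕ × ℕ}

theorem sizeStep_mono (hε : Antitone ε) (hε' : ∀ t, ε t ∈ Set.Ioo (0 : ℝ) (1 / 2))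
    (hG : Monotone G) : Monotone (sizeStep ε G) := by
  intro S T hST
  have hT := (hε' T).1
  have hle := hε hST
  have hlog : 0 ≤ Real.log (1 / ε S) :=
    Real.log_nonneg ((one_le_div (hε' S).1).mpr (by linarith [(hε' S).2]))
  have h₁ : ⌈400 / ε S ^ 2⌉₊ ≤ ⌈400 / ε T ^ 2⌉₊ := Nat.ceil_mono (by gcongr)
  have h₂ : ⌈400 / ε S ^ 3 * Real.log (1 / ε S) ^ 1⌉₊ ≤
      ⌈400 / ε T ^ 3 * Real.log (1 / ε T) ^ 1⌉₊ := by
    have := (hε' S).1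
    exact Nat.ceil_mono (by gcongr)
  have hGST := hG hST
  exact ⟨by simpa [sizeStep] using Nat.mul_le_mul h₁ hGST.1,
    by simpa [sizeStep] using Nat.add_le_add (Nat.mul_le_mul h₁ hGST.2) h₂⟩

/-- The run may start at (0, 0), because the constant 1/2 needs neither inputs nor gates. -/
theorem iterate_sizeStep_le_sizeBound (hmono : Monotone (sizeStep ε G)) (i : ℕ) :
    (sizeStep ε G)^[i] (0, 0) ≤ sizeBound ε G 400 1 i := by
  induction i with
  | zero => exact ⟨Nat.zero_le _, Nat.zero_le _⟩
  | succ i ih =>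
    rw [Function.iterate_succ_apply']
    exact hmono ih

end Sizes

/-! ### Stages of the run and both conclusions -/

section Main

variable {X : Type*} [Fintype X] {D : X → ℝ} {F : Set (X → unitInterval)} {g : X → unitInterval}
  {ε : ℕ × ℕ → ℝ} {G : ℕ × ℕ → ℕ × ℕ} {s s' : ℕ × ℕ}

/-- The state of the boosting run at size bound `S`: it has used functions from `F_{G(S)}`, it has
not taken more steps than its energy allows, and its prediction lies in `F_S`. -/
def IsStage (D : X → ℝ) (F : Set (X → unitInterval)) (g : X → unitInterval) (ε : ℕ × ℕ → ℝ)
    (G : ℕ × ℕ → ℕ × ℕ) (S : ℕ × ℕ) (H : X → ℝ) : Prop :=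
  (∃ n : ℕ, IsBoost F (G S) (stepExponent (ε S)) n H ∧
    energy D g H + 13 / 64 * (n * ε S ^ 2) ≤ 1 / 4) ∧
  (fun x => clip (H x)) ∈ simClass F S

theorem isStage_zero (hD : D ∈ stdSimplex ℝ X) : IsStage D F g ε G (0, 0) fun _ => 1 / 2 := by
  refine ⟨⟨0, .zero, by simpa using energy_half_le hD⟩, ?_⟩
  refine bitsComputable_empty.const.mem_simClass (m := 2) (c := ![fun _ => false, fun _ => true])
    (fun j => ?_) fun x => ?_
  · fin_cases j
    · exact Or.inr ⟨false, rfl⟩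
    · exact Or.inr ⟨true, rfl⟩
  · rw [coe_clip, ofBits, Fin.sum_univ_two]
    norm_num

theorem IsStage.exists_next (hD : D ∈ stdSimplex ℝ X) (hε : Antitone ε)
    (hε' : ∀ t, ε t ∈ Set.Ioo (0 : ℝ) (1 / 2)) (hG : Monotone G) {S : ℕ × ℕ}
    (hS : S ≤ sizeStep ε G S) {H : X → ℝ} (hH : IsStage D F g ε G S H) :
    ∃ H', IsStage D F g ε G (sizeStep ε G S) H' ∧
      IsRegular D (simClass F (G S)) (ε S) g (fun x => clip (H' x)) ∧
      (expect D fun x => ((clip (H x) : ℝ) - clip (H' x)) ^ 2) ≤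
        29 / 13 * (energy D g H - energy D g H') := by
  obtain ⟨⟨n₀, hboost, henergy⟩, -⟩ := hH
  obtain ⟨he, he'⟩ := hε' S
  obtain ⟨n, H', hboost', hdrop, hreg, hcross⟩ :=
    exists_regular_boost (g := g) hD he (half_pow_stepExponent_le he) hboost
  have hδ := lt_half_pow_stepExponent he he'
  have hδ' := half_pow_stepExponent_le he
  have hE' := energy_nonneg (g := g) hD H'
  have hn0 : (0 : ℝ) ≤ n := Nat.cast_nonneg n
  -- Each step lowers the energy by at least 13δe/8 ≥ 13e²/64, since δ > e/8.
  have hbudget : energy D g H' + 13 / 64 * (((n₀ + n : ℕ) : ℝ) * ε S ^ 2) ≤ 1 / 4 := by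
    have : n * (ε S / 8 * ε S) ≤ n * ((1 / 2) ^ stepExponent (ε S) * ε S) := by gcongr
    push_cast
    linarith
  have hcount : ((n₀ + n : ℕ) : ℝ) * ε S ^ 2 ≤ 2 := by linarith
  have hcount' : n₀ + n ≤ 2 ^ (2 * stepExponent (ε S)) := by
    have h16 : 16 / ε S ^ 2 ≤ 2 ^ (2 * stepExponent (ε S)) := by
      have h4 : 4 / ε S ≤ 2 ^ stepExponent (ε S) := by
        rw [one_div_pow, one_div_le (by positivity) (by positivity), one_div_div] at hδ'
        exact hδ'
      calc 16 / ε S ^ 2 = (4 / ε S) ^ 2 := by ring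
        _ ≤ (2 ^ stepExponent (ε S)) ^ 2 := by gcongr
        _ = _ := by rw [← pow_mul, mul_comm]
    have : ((n₀ + n : ℕ) : ℝ) ≤ 16 / ε S ^ 2 := by
      rw [le_div_iff₀ (by positivity)]
      linarith
    exact_mod_cast this.trans h16
  have hceil : n₀ + n ≤ ⌈400 / ε S ^ 2⌉₊ := by
    have : ((n₀ + n : ℕ) : ℝ) ≤ 400 / ε S ^ 2 := by
      rw [le_div_iff₀ (by positivity)]
      linarith
    exact_mod_cast this.trans (Nat.le_ceil _)
  -- Old steps stay admissible: G(S) grows, and a smaller ε permits larger exponents.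
  refine ⟨H', ⟨⟨n₀ + n, hboost'.mono (hG hS) (stepExponent_anti (hε' _).1 (hε hS)), ?_⟩, ?_⟩,
    hreg, ?_⟩
  · have h0 := (hε' (sizeStep ε G S)).1
    have : ((n₀ + n : ℕ) : ℝ) * ε (sizeStep ε G S) ^ 2 ≤ ((n₀ + n : ℕ) : ℝ) * ε S ^ 2 := by
      gcongr
      exact hε hS
    linarith
  · refine simClass_mono (add_le_add ?_ ?_) (hboost'.clip_mem hcount')
    · exact ⟨Nat.mul_le_mul_right _ hceil, Nat.mul_le_mul_right _ hceil⟩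
    · exact ⟨le_rfl, gate_count_le he he' hcount⟩
  -- The drop is at least 13nδe/8, so the cross term 2nδe is at most 16/13 of it, and 1 + 16/13 =
  -- 29/13.
  · have h := expect_sq_sub_le (g := g) hD H H'
    have := (abs_le.mp hcross).1
    linarith

theorem exists_isSupersimulatorPair (hD : D ∈ stdSimplex ℝ X) (F : Set (X → unitInterval))
    (g : X → unitInterval) (hε : Antitone ε) (hε' : ∀ t, ε t ∈ Set.Ioo (0 : ℝ) (1 / 2)) {α : ℝ}
    (hα : α ∈ Set.Ioo (0 : ℝ) (1 / 2)) (hG : Monotone G) :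
    ∃ (s s' : ℕ × ℕ) (h h' : X → unitInterval),
      IsSupersimulatorPair 1 400 1 D F g ε α G s s' h h' := by
  by_contra! hcon
  obtain ⟨hα0, hα1⟩ := hα
  have hmono := sizeStep_mono hε hε' hG
  have hT : Monotone fun i => (sizeStep ε G)^[i] (0, 0) :=
    hmono.monotone_iterate_of_le_map ⟨Nat.zero_le _, Nat.zero_le _⟩
  have hbound : ∀ i ≤ ⌊1 / α⌋₊, (sizeStep ε G)^[i] (0, 0) ≤ sizeBound ε G 400 1 ⌊1 / α⌋₊ :=
    fun i hi => (hT hi).trans (iterate_sizeStep_le_sizeBound hmono _)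
  have key : ∀ i ≤ ⌊1 / α⌋₊, ∃ H, IsStage D F g ε G ((sizeStep ε G)^[i] (0, 0)) H ∧
      energy D g H + i * (13 / 29 * α) ≤ 1 / 4 := by
    intro i
    induction i with
    | zero => exact fun _ => ⟨_, isStage_zero hD, by simpa using energy_half_le hD⟩
    | succ i ih =>
      intro hi
      obtain ⟨H, hH, hE⟩ := ih (Nat.le_of_succ_le hi)
      have hle := hT (Nat.le_succ i)
      simp only [Nat.succ_eq_add_one, Function.iterate_succ_apply'] at hle
      obtain ⟨H', hH', hreg, hsim⟩ := hH.exists_next hD hε hε' hG hle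
      rw [Function.iterate_succ_apply']
      refine ⟨H', hH', ?_⟩
      -- A drop below 13α/29 makes the squared distance less than α, so the two ends form a pair.
      by_contra hlarge
      refine hcon _ _ _ _ ⟨hH.2, hH'.2, hsim.trans ?_, hreg, hbound i (Nat.le_of_succ_le hi), ?_⟩
      · have := (hε' ((sizeStep ε G)^[i] (0, 0))).1
        push_cast at hlarge
        linarith
      · rw [← Function.iterate_succ_apply' (sizeStep ε G)]
        exact hbound (i + 1) hi
  obtain ⟨H, -, hE⟩ := key _ le_rfl
  have hE0 := energy_nonneg (g := g) hD H
  have hfloor := Nat.lt_floor_add_one (1 / α)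
  -- From ⌊1/α⌋ ≥ 2 follows α⌊1/α⌋ > 2/3, and (13/29)(2/3) > 1/4.
  have htwo : (2 : ℝ) ≤ (⌊1 / α⌋₊ : ℕ) := by
    have : 2 ≤ ⌊1 / α⌋₊ := Nat.le_floor (by rw [le_div_iff₀ hα0]; push_cast; linarith)
    exact_mod_cast this
  rw [div_lt_iff₀ hα0] at hfloor
  nlinarith

theorem IsSupersimulatorPair.isRegular_left {A B : ℝ} (hA : 0 < A) {c : ℕ} {α : ℝ}
    {h h' : X → unitInterval} (hD : D ∈ stdSimplex ℝ X)
    (hε' : ∀ t, ε t ∈ Set.Ioo (0 : ℝ) (1 / 2)) (hα : α ∈ Set.Ioo (0 : ℝ) (1 / 2))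
    (hp : IsSupersimulatorPair A B c D F g ε α G s s' h h') :
    IsRegular D (simClass F (G s))
      (((1 + √(1 + A)) ^ 3 * (α + ε s)) ^ ((1 : ℝ) / 3)) g h := by
  intro f hf
  obtain ⟨he0, he1⟩ := hε' s
  obtain ⟨hα0, hα1⟩ := hα
  set y := α + ε s with hy
  have hy0 : 0 < y := by positivity
  have hsplit : (expect D fun x => (f x : ℝ) * ((g x : ℝ) - h x)) =
      (expect D fun x => (f x : ℝ) * ((g x : ℝ) - h' x)) +
        -1 * expect D fun x => (f x : ℝ) * ((h x : ℝ) - h' x) := by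
    rw [← expect_const_mul, ← expect_add]
    congr 1
    funext x
    ring
  have hdiff : |expect D fun x => (f x : ℝ) * ((h x : ℝ) - h' x)| ≤ √(1 + A) * √y := by
    rw [← Real.sqrt_mul (by positivity)]
    refine Real.abs_le_sqrt ((sq_expect_le hD _).trans ?_)
    refine (expect_mono hD fun x => ?_).trans (hp.similarity.trans ?_)
    · rw [mul_pow]
      exact mul_le_of_le_one_left (sq_nonneg _) (pow_le_one₀ (f x).2.1 (f x).2.2)
    · nlinarith
  have hsqrt : √y ^ 2 = y := Real.sq_sqrt hy0.le
  have hsqrt0 : 0 ≤ √y := Real.sqrt_nonneg y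
  have hsqrt1 : √y ≤ 1 := Real.sqrt_le_one.mpr (by linarith)
  have hle : |expect D fun x => (f x : ℝ) * ((g x : ℝ) - h x)| ≤ (1 + √(1 + A)) * √y := by
    rw [hsplit]
    refine (abs_add_le _ _).trans ?_
    rw [neg_one_mul, abs_neg]
    have := hp.regularity f hf
    nlinarith
  refine hle.trans ?_
  -- With C = 1 + √(1 + A), the cube of C√y is at most C³y because y ≤ 1.
  have hcube := Real.pow_rpow_inv_natCast (x := (1 + √(1 + A)) * √y) (by positivity)
    (show 3 ≠ 0 by norm_num)
  rw [← hcube, one_div, Nat.cast_ofNat]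
  refine Real.rpow_le_rpow (by positivity) ?_ (by norm_num)
  rw [mul_pow]
  refine mul_le_mul_of_nonneg_left ?_ (by positivity)
  nlinarith

end Main

end Supersimulator

theorem mainTheorem8 :
    -- For suitable absolute constants such pairs always exist,
    (∃ A B : ℝ, ∃ c : ℕ, 0 < A ∧ 0 < B ∧
      ∀ (X : Type*) [Fintype X] (D : X → ℝ) (_ : D ∈ stdSimplex ℝ X)
        (F : Set (X → unitInterval)) (g : X → unitInterval)
        (ε : ℕ × ℕ → ℝ) (_ : Antitone ε) (_ : ∀ t, ε t ∈ Set.Ioo (0 : ℝ) (1 / 2))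
        (α : ℝ) (_ : α ∈ Set.Ioo (0 : ℝ) (1 / 2))
        (G : ℕ × ℕ → ℕ × ℕ) (_ : Monotone G),
        ∃ (s s' : ℕ × ℕ) (h h' : X → unitInterval),
          Supersimulator.IsSupersimulatorPair A B c D F g ε α G s s' h h') ∧
    -- and for every such pair, whatever the constants, `h` itself is regular.
    (∀ A : ℝ, 0 < A → ∃ K : ℝ, 0 < K ∧ ∀ B : ℝ, 0 < B → ∀ c : ℕ,
      ∀ (X : Type*) [Fintype X] (D : X → ℝ) (_ : D ∈ stdSimplex ℝ X)
        (F : Set (X → unitInterval)) (g : X → unitInterval)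
        (ε : ℕ × ℕ → ℝ) (_ : Antitone ε) (_ : ∀ t, ε t ∈ Set.Ioo (0 : ℝ) (1 / 2))
        (α : ℝ) (_ : α ∈ Set.Ioo (0 : ℝ) (1 / 2))
        (G : ℕ × ℕ → ℕ × ℕ) (_ : Monotone G)
        (s s' : ℕ × ℕ) (h h' : X → unitInterval),
          Supersimulator.IsSupersimulatorPair A B c D F g ε α G s s' h h' →
          Supersimulator.IsRegular D (Supersimulator.simClass F (G s))
            ((K * (α + ε s)) ^ ((1 : ℝ) / 3)) g h) := by
  refine ⟨⟨1, 400, 1, by norm_num, by norm_num, ?_⟩,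
    fun A hA => ⟨(1 + √(1 + A)) ^ 3, by positivity, ?_⟩⟩
  · intro X _ D hD F g ε hε hε' α hα G hG
    exact Supersimulator.exists_isSupersimulatorPair hD F g hε hε' hα hG
  · intro B _ c X _ D hD F g ε _ hε' α hα G _ s s' h h' hp
    exact hp.isRegular_left hA hD hε' hα
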